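/- Consider a $K$ user parallel ADT deterministic interference network with $M$ sub-channels and strength levels $n_{ki}^{[m]}\in\{0,1,2,\dots\}$ from Transmitter $i$ to Receiver $k$ over sub-channel $m$. In every channel use and on every sub-channel, each Transmitter $i$ sends $X_i^{[m]}=0.X^{[m]}_{i,(1)}X^{[m]}_{i,(2)}\ldots$ (in base $2$), and each Receiver $k$ observes $Y_k^{[m]}=\bigoplus_{i}\lfloor 2^{n_{ki}^{[m]}}X_i^{[m]}\rfloor$ (bit-wise modulo two), so that the bit $X^{[m]}_{i,(b)}$ with $b\le n_{ki}^{[m]}$ is received at the level of weight $2^{\,n_{ki}^{[m]}-b}$. The capacity region is the closure of the set of rate tuples in $\mathbb{R}_{\ge 0}^K$ for which there are block codes (independent uniform messages, joint coding over all sub-channels) whose error probability at every receiver tends to $0$ as the block length grows; the sum-capacity is the maximum of the sum-rate over it. A cyclic partition $\Pi$ of the users is a partition of $\{1,\dots,K\}$ into disjoint cyclically ordered subsets, i.e. a permutation $\Pi$ of the users whose fixed points are the trivial cycles. Its weight in sub-channel $m$ is $w^{[m]}(\Pi)=\sum_{i:\Pi(i)\ne i}n^{[m]}_{\Pi(i)i}$,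 and $\Pi$ is optimal for sub-channel $m$ if it minimizes the bound $\sum_k n_{kk}^{[m]}-w^{[m]}(\Pi)$. Given $\Pi$, the participating input levels of sub-channel $m$ are the bits $X^{[m]}_{i,(b)}$ with $\Pi(i)\neq i$ and $1\le b\le n^{[m]}_{\Pi(i)i}$. With $X_{i,u}^{[m]}$ the input of Transmitter $i$ in which all other bits are $0$, the participating output at Receiver $k$ is $Y_{k,u}^{[m]}=\bigoplus_{i\ne k}\lfloor 2^{n_{ki}^{[m]}}X_{i,u}^{[m]}\rfloor$, and the participating output levels of Receiver $k$ are the levels at which it receives some participating input level of another transmitter. Sub-channel $m$ is invertible under $\Pi$ if the map $(X_{i,u}^{[m]})_i\mapsto(Y_{k,u}^{[m]})_k$ is injective, and it is invertible if this holds for an optimal $\Pi$. Let $G^{[m]}_\Pi$ be the undirected bipartite graph between the participating input levels and the participating output levels whose edges are the cross links, i.e. an input level of Transmitter $i$ is joined to the level of Receiver $k\ne i$ at which it is received. A sub-channel is TIN optimal if $n_{ii}^{[m]}\ge\max_{j\ne i}n_{ji}^{[m]}+\max_{k\ne i}n_{ik}^{[m]}$ for all $i$ (a maximum over the empty set being $0$).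 In separate TIN, on each sub-channel each Transmitter $i$ reduces its power by some integer number $r_i^{[m]}\ge 0$ of levels (its first $r_i^{[m]}$ bits are $0$) and sends independent uniform bits on the remaining levels; each receiver treats interference as noise, so that user $i$ has rate $\sum_m I(X_i^{[m]};Y_i^{[m]})$. Theorem 7. (1) For every sub-channel $m$ and every cyclic partition $\Pi$, if $G^{[m]}_\Pi$ is acyclic, then sub-channel $m$ is invertible under $\Pi$. In particular, if $G^{[m]}_\Pi$ is acyclic for an optimal cyclic partition $\Pi$, then sub-channel $m$ is invertible. (2) If for every sub-channel $m$ the graph $G^{[m]}_\Pi$ is acyclic for some optimal cyclic partition $\Pi=\Pi^{[m]}$, and each sub-channel is TIN optimal, then separate TIN over each sub-channel achieves the sum-capacity of the $K$ user parallel ADT deterministic interference network: for some choice of the $r_i^{[m]}$, the rate tuple of separate TIN lies in the capacity region and its sum is the sum-capacity. -/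

import Mathlib

open Filter Topology

noncomputable section

namespace ADT

/-! ### The channel

A `K` user network with `M` parallel sub-channels is given by its channel strength levels
`n : Fin M → Fin K → Fin K → ℕ`, where `n m k i` is the strength level from Transmitter `i` to
Receiver `k` over sub-channel `m`.  A single sub-channel is given by `N : Fin K → Fin K → ℕ`.

A channel input `0.x₀x₁x₂…` (in base 2) is the sequence of its bits: `x b` has weight `2 ^ (-(b+1))`.
A received signal is the sequence of its bits: `y l` has weight `2 ^ l`. -/

/-- A sequence of bits, with addition modulo two. -/
abbrev Bits : Type := ℕ → ZMod 2

/-- The bits of `⌊2 ^ s * X⌋`, for the input `X = 0.x₀x₁x₂…`: the bit `x b` arrives at the level `l`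
with `l + b + 1 = s`, and the bits `x b` with `b ≥ s` are lost. -/
def shift (s : ℕ) (x : Bits) : Bits :=
  fun l => if l < s then x (s - 1 - l) else 0

/-- The signal at Receiver `k` over one sub-channel: the bit-wise sum modulo two of
`⌊2 ^ (N k i) * X i⌋` over all transmitters `i`. -/
def output {K : ℕ} (N : Fin K → Fin K → ℕ) (x : Fin K → Bits) (k : Fin K) : Bits :=
  ∑ i, shift (N k i) (x i)

/-! ### Codes and capacity -/

/-- The number of messages of a user of rate `R` when the channel is used `T` times. -/
def numMessages (T : ℕ) (R : ℝ) : ℕ := ⌈(2 : ℝ) ^ ((T : ℝ) * R)⌉₊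

/-- A code of block length `T` and rates `R`: Transmitter `i` maps its own message to bit sequences
for each channel use and each sub-channel, and Receiver `k` estimates its message from what it
receives in all channel uses and over all sub-channels. -/
structure Code (K M T : ℕ) (R : Fin K → ℝ) where
  enc : (i : Fin K) → Fin (numMessages T (R i)) → Fin T → Fin M → Bits
  dec : (k : Fin K) → (Fin T → Fin M → Bits) → Fin (numMessages T (R k))

/-- What Receiver `k` receives if the messages are `w`. -/
def Code.received {K M T : ℕ} {R : Fin K → ℝ} (c : Code K M T R) (n : Fin M → Fin K → Fin K → ℕ)
    (w : (i : Fin K) → Fin (numMessages T (R i))) (k : Fin K) : Fin T → Fin M → Bits :=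
  fun t m => output (n m) (fun i => c.enc i (w i) t m) k

/-- The probability that Receiver `k` decodes wrongly, for independent uniform messages. -/
def Code.errorProb {K M T : ℕ} {R : Fin K → ℝ} (c : Code K M T R) (n : Fin M → Fin K → Fin K → ℕ)
    (k : Fin K) : ℝ :=
  (Nat.card {w : (i : Fin K) → Fin (numMessages T (R i)) // c.dec k (c.received n w k) ≠ w k} : ℝ) /
    (Nat.card ((i : Fin K) → Fin (numMessages T (R i))) : ℝ)

/-- Achievable rate tuples: for codes of growing block length, the error probability at every
receiver tends to zero. -/
def Achievable {K M : ℕ} (n : Fin M → Fin K → Fin K → ℕ) (R : Fin K → ℝ) : Prop :=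
  (∀ i, 0 ≤ R i) ∧
    ∃ c : (T : ℕ) → Code K M T R,
      ∀ k, Tendsto (fun T => (c T).errorProb n k) atTop (𝓝 0)

/-- The capacity region: the closure of the set of achievable rate tuples. -/
def capacityRegion {K M : ℕ} (n : Fin M → Fin K → Fin K → ℕ) : Set (Fin K → ℝ) :=
  closure {R | Achievable n R}

/-- `C` is the sum-capacity: the maximum of the sum-rate over the capacity region. -/
def IsSumCapacity {K M : ℕ} (n : Fin M → Fin K → Fin K → ℕ) (C : ℝ) : Prop :=
  IsGreatest ((fun R : Fin K → ℝ => ∑ k, R k) '' capacityRegion n) C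

/-! ### Treating interference as noise (TIN) -/

/-- The TIN optimality condition for a sub-channel: for each user, the desired signal strength is at
least the sum of the strongest interference caused and the strongest interference suffered by it
(a maximum over no users is zero). -/
def TINOptimal {K : ℕ} (N : Fin K → Fin K → ℕ) : Prop :=
  ∀ i, (Finset.univ.erase i).sup (fun j => N j i) + (Finset.univ.erase i).sup (fun k => N i k) ≤ N i i

/-- The Shannon entropy, in bits, of the random variable `f` on a finite space `Ω` with the uniform
distribution: the expectation of `-log₂ p(f)`, with `p` the probability mass function of `f`. -/
def entropy {Ω α : Type} [Fintype Ω] (f : Ω → α) : ℝ :=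
  (∑ ω, -Real.logb 2 ((Nat.card {ω' // f ω' = f ω} : ℝ) / (Fintype.card Ω : ℝ))) /
    (Fintype.card Ω : ℝ)

/-- The mutual information, in bits, of two random variables on a finite space with the uniform
distribution. -/
def mutualInfo {Ω α β : Type} [Fintype Ω] (f : Ω → α) (g : Ω → β) : ℝ :=
  entropy f + entropy g - entropy (fun ω => (f ω, g ω))

/-- The greatest strength level in a sub-channel; no bit beyond this one reaches any receiver. -/
def maxLevel {K : ℕ} (N : Fin K → Fin K → ℕ) : ℕ :=
  Finset.univ.sup fun k => Finset.univ.sup (N k)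

/-- The power controlled input of Transmitter `j`: its power is reduced by `r j` levels, so that its
first `r j` bits are zero; the other bits that can reach a receiver are taken from `U`. -/
def tinInput {K : ℕ} (N : Fin K → Fin K → ℕ) (r : Fin K → ℕ)
    (U : Fin K → Fin (maxLevel N) → ZMod 2) (j : Fin K) : Bits :=
  fun b => if h : b < maxLevel N then (if r j ≤ b then U j ⟨b, h⟩ else 0) else 0

/-- The rate of user `i` on a sub-channel under power control `r` when interference is treated as
noise: the mutual information `I(X i; Y i)` between the input of Transmitter `i` and the signal at
Receiver `i`, where all transmitters send independent uniform bits on the levels that their power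
leaves them. -/
def tinRate {K : ℕ} (N : Fin K → Fin K → ℕ) (r : Fin K → ℕ) (i : Fin K) : ℝ :=
  mutualInfo (Ω := Fin K → Fin (maxLevel N) → ZMod 2)
    (fun U => tinInput N r U i) (fun U => output N (tinInput N r U) i)

/-- The rate tuple of separate TIN over each sub-channel, with power control `r m` on sub-channel
`m`: the rates of a user on the sub-channels add up. -/
def separateTINRates {K M : ℕ} (n : Fin M → Fin K → Fin K → ℕ) (r : Fin M → Fin K → ℕ) :
    Fin K → ℝ :=
  fun i => ∑ m, tinRate (n m) (r m) i

/-- Separate TIN over each sub-channel achieves the sum-capacity. -/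
def SeparateTINAchievesSumCapacity {K M : ℕ} (n : Fin M → Fin K → Fin K → ℕ) : Prop :=
  ∃ r : Fin M → Fin K → ℕ,
    separateTINRates n r ∈ capacityRegion n ∧ IsSumCapacity n (∑ i, separateTINRates n r i)

/-! ### Cyclic partitions

A partition of the users into vertex-disjoint cyclically ordered subsets is a permutation `P` of the
users.  Its edges go from user `k` to user `P k`, the cyclic predecessor of `k`; the trivial
cycles are the fixed points of `P`. -/

/-- The strength of the participating edge that leaves user `i`, which is zero if `i` is in a
trivial cycle.  This is also the number of participating input levels of Transmitter `i`. -/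
def edgeWeight {K : ℕ} (N : Fin K → Fin K → ℕ) (P : Equiv.Perm (Fin K)) (i : Fin K) : ℕ :=
  if P i = i then 0 else N (P i) i

/-- The cyclic partition bound: the sum of the desired strengths minus the weight of the
partition. -/
def cyclicPartitionBound {K : ℕ} (N : Fin K → Fin K → ℕ) (P : Equiv.Perm (Fin K)) : ℤ :=
  ∑ k, (N k k : ℤ) - ∑ k, (edgeWeight N P k : ℤ)

/-- An optimal cyclic partition is one with the least cyclic partition bound. -/
def OptimalPartition {K : ℕ} (N : Fin K → Fin K → ℕ) (P : Equiv.Perm (Fin K)) : Prop :=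
  ∀ Q : Equiv.Perm (Fin K), cyclicPartitionBound N P ≤ cyclicPartitionBound N Q

/-! ### Participating levels and invertibility -/

/-- Participating input levels: the bits that are sent from a Transmitter `i` and observed at the
receiver of its cyclic predecessor `P i ≠ i`. -/
abbrev InLevel {K : ℕ} (N : Fin K → Fin K → ℕ) (P : Equiv.Perm (Fin K)) : Type :=
  (i : Fin K) × Fin (edgeWeight N P i)

/-- The participating input of Transmitter `i`: the input of which all other bits are zero. -/
def participatingInput {K : ℕ} (N : Fin K → Fin K → ℕ) (P : Equiv.Perm (Fin K))
    (X : InLevel N P → ZMod 2) (i : Fin K) : Bits :=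
  fun b => if h : b < edgeWeight N P i then X ⟨i, ⟨b, h⟩⟩ else 0

/-- The participating output at each Receiver `k`: the interference that results from the
participating inputs of the other transmitters. -/
def participatingOutput {K : ℕ} (N : Fin K → Fin K → ℕ) (P : Equiv.Perm (Fin K))
    (X : InLevel N P → ZMod 2) : Fin K → Bits :=
  fun k => ∑ i ∈ Finset.univ.erase k, shift (N k i) (participatingInput N P X i)

/-- A sub-channel is invertible under `P` if the participating inputs are determined by the
participating outputs. -/
def InvertibleUnder {K : ℕ} (N : Fin K → Fin K → ℕ) (P : Equiv.Perm (Fin K)) : Prop :=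
  Function.Injective (participatingOutput N P)

/-- A sub-channel is invertible if it is so under an optimal cyclic partition. -/
def Invertible {K : ℕ} (N : Fin K → Fin K → ℕ) : Prop :=
  ∃ P, OptimalPartition N P ∧ InvertibleUnder N P

/-! ### The bipartite graph -/

/-- There is a cross link from the participating input level `x` to the level `y.2` of Receiver
`y.1`: this is another user, and it receives the bit `x` at that level. -/
def CrossLink {K : ℕ} (N : Fin K → Fin K → ℕ) (P : Equiv.Perm (Fin K))
    (x : InLevel N P) (y : Fin K × ℕ) : Prop :=
  x.1 ≠ y.1 ∧ y.2 + (x.2 : ℕ) + 1 = N y.1 x.1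

/-- Participating output levels: the received levels that result from some interfering participating
input level. -/
abbrev OutLevel {K : ℕ} (N : Fin K → Fin K → ℕ) (P : Equiv.Perm (Fin K)) : Type :=
  {y : Fin K × ℕ // ∃ x : InLevel N P, CrossLink N P x y}

/-- The undirected bipartite graph of cross links between the participating input and output
levels. -/
def levelGraph {K : ℕ} (N : Fin K → Fin K → ℕ) (P : Equiv.Perm (Fin K)) :
    SimpleGraph (InLevel N P ⊕ OutLevel N P) :=
  SimpleGraph.fromRel fun a b =>
    ∃ (x : InLevel N P) (y : OutLevel N P), a = Sum.inl x ∧ b = Sum.inr y ∧ CrossLink N P x y.1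

end ADT

end

/-! Part (1). Each participating input level `x` of user `i` has a private output level, its target
at Receiver `P i`, and distinct inputs have distinct targets. If a nonzero participating input gave
zero output, then at the target of each nonzero bit another nonzero bit would have to cancel it.
Alternating "go to the target, go to the cancelling bit" never turns back, so in an acyclic graph it
traces arbitrarily long paths, which a finite graph does not have (`invertibleUnder_of_isAcyclic`).

Part (2), converse. Let `V k` be the interference at Receiver `k` and `G k` the bits of user `k`
that some other receiver can observe. Fano bounds the rate of user `k` by `H(Y k) - H(V k)`. TIN
optimality puts `G k` above the interference at its own receiver, so `H(Y k)` exceeds `H(G k)` by at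
most the number of remaining levels. The `G k` are independent, and by invertibility they are
jointly determined by the `V k` and the nonparticipating bits among them. Hence `∑ H(G k)` exceeds
`∑ H(V k)` by at most the number of those bits. The entropies cancel, leaving the sum of the cyclic
partition bounds (`sum_le_of_mem_capacityRegion`).

Part (2), achievability. An optimal cyclic partition is a maximum weight assignment, so it has an
integral dual solution: `u` on transmitters, `v` on receivers, tight along the partition
(`OptimalPartition.exists_potentials`). Reducing the power of Transmitter `i` by `u i` levels
confines the interference at Receiver `k` to its lowest `v k` levels, so user `i` gets `N i i - u i
- v i`. By tightness these rates sum to the bound. They are integers and are attained without error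
by uncoded bits. -/

namespace ADT

/-! ### Shannon entropy on a finite uniform space, up to Fano's inequality -/

section Entropy

variable {Ω α β : Type} [Fintype Ω]

/-- The probability that `f` takes the value `a`, under the uniform distribution. -/
noncomputable def prob (f : Ω → α) (a : α) : ℝ :=
  (Nat.card {ω // f ω = a} : ℝ) / (Fintype.card Ω : ℝ)

theorem entropy_eq (f : Ω → α) :
    entropy f = (∑ ω, -Real.logb 2 (prob f (f ω))) / (Fintype.card Ω : ℝ) := rfl

theorem prob_apply_pos (f : Ω → α) (ω : Ω) : 0 < prob f (f ω) := by
  have : Nonempty {ω' // f ω' = f ω} := ⟨⟨ω, rfl⟩⟩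
  have : Nonempty Ω := ⟨ω⟩
  have h1 : 0 < Nat.card {ω' // f ω' = f ω} := Nat.card_pos
  have h2 : 0 < Fintype.card Ω := Fintype.card_pos
  unfold prob
  positivity

theorem prob_apply_le_one (f : Ω → α) (a : α) : prob f a ≤ 1 := by
  unfold prob
  refine div_le_one_of_le₀ ?_ (by positivity)
  rw [← Nat.card_eq_fintype_card]
  exact_mod_cast Nat.card_le_card_of_injective _ Subtype.val_injective

/-- Averages of functions of `f` are sums over the values of `f`. -/
theorem sum_comp_eq_sum_image [DecidableEq α] (f : Ω → α) (g : α → ℝ) :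
    ∑ ω, g (f ω) = ∑ a ∈ Finset.univ.image f, Fintype.card Ω * (prob f a * g a) := by
  classical
  rw [Finset.sum_comp]
  refine Finset.sum_congr rfl fun a ha => ?_
  obtain ⟨ω, -, rfl⟩ := Finset.mem_image.1 ha
  have : (Fintype.card Ω : ℝ) ≠ 0 := by
    have : Nonempty Ω := ⟨ω⟩
    exact_mod_cast Fintype.card_ne_zero
  unfold prob
  rw [Nat.card_eq_fintype_card, Fintype.card_subtype, nsmul_eq_mul]
  field_simp

theorem sum_prob_le_one [DecidableEq α] (f : Ω → α) : ∑ a ∈ Finset.univ.image f, prob f a ≤ 1 := by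
  rcases isEmpty_or_nonempty Ω with h | h
  · simp
  · have h1 := sum_comp_eq_sum_image f fun _ => 1
    have h2 : (Fintype.card Ω : ℝ) ≠ 0 := by exact_mod_cast Fintype.card_ne_zero
    simp only [Finset.sum_const, Finset.card_univ, nsmul_eq_mul, mul_one, ← Finset.mul_sum] at h1
    exact (mul_left_cancel₀ h2 (h1.symm.trans (mul_one _).symm)).le

/-- Gibbs' inequality: the entropy is at most the cross entropy. -/
theorem entropy_le_crossEntropy [DecidableEq α] (f : Ω → α) (q : α → ℝ) (hq : ∀ ω, 0 < q (f ω))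
    (hsum : ∑ a ∈ Finset.univ.image f, q a ≤ 1) :
    entropy f ≤ (∑ ω, -Real.logb 2 (q (f ω))) / (Fintype.card Ω : ℝ) := by
  rw [entropy_eq]
  refine div_le_div_of_nonneg_right ?_ (by positivity)
  have hlog : 0 < Real.log 2 := Real.log_pos one_lt_two
  -- This is `log x ≤ x - 1` at `x = q / p`; averaged over `ω`, the right side is at most zero.
  have key : ∀ ω, -Real.logb 2 (prob f (f ω)) - -Real.logb 2 (q (f ω)) ≤
      (q (f ω) / prob f (f ω) - 1) / Real.log 2 := by
    intro ω
    have hp := prob_apply_pos f ω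
    have h := Real.log_le_sub_one_of_pos (div_pos (hq ω) hp)
    rw [Real.log_div (hq ω).ne' hp.ne'] at h
    unfold Real.logb
    rw [← neg_div, ← neg_div, ← sub_div]
    exact div_le_div_of_nonneg_right (by linarith) hlog.le
  have hsum' := Finset.sum_le_sum fun ω (_ : ω ∈ Finset.univ) => key ω
  rw [Finset.sum_sub_distrib, ← Finset.sum_div, Finset.sum_sub_distrib] at hsum'
  have h2 : ∑ ω, q (f ω) / prob f (f ω) ≤ Fintype.card Ω := by
    rw [sum_comp_eq_sum_image f fun a => q a / prob f a, ← Finset.mul_sum]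
    have : ∑ a ∈ Finset.univ.image f, prob f a * (q a / prob f a) ≤ 1 := by
      refine (Finset.sum_congr rfl fun a ha => ?_).trans_le hsum
      obtain ⟨ω, -, rfl⟩ := Finset.mem_image.1 ha
      have := (prob_apply_pos f ω).ne'
      field_simp
    exact mul_le_of_le_one_right (Nat.cast_nonneg _) this
  have h3 : (∑ ω, q (f ω) / prob f (f ω) - ∑ ω : Ω, (1 : ℝ)) / Real.log 2 ≤ 0 := by
    refine div_nonpos_of_nonpos_of_nonneg ?_ hlog.le
    simpa using h2
  linarith

/-- Gibbs' inequality against the product of the marginals. -/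
theorem entropy_pair_le (f : Ω → α) (g : Ω → β) :
    entropy (fun ω => (f ω, g ω)) ≤ entropy f + entropy g := by
  classical
  refine (entropy_le_crossEntropy (fun ω => (f ω, g ω)) (fun p => prob f p.1 * prob g p.2)
    (fun ω => mul_pos (prob_apply_pos f ω) (prob_apply_pos g ω)) ?_).trans_eq ?_
  · calc ∑ p ∈ Finset.univ.image fun ω => (f ω, g ω), prob f p.1 * prob g p.2
        ≤ ∑ p ∈ Finset.univ.image f ×ˢ Finset.univ.image g, prob f p.1 * prob g p.2 := by
          refine Finset.sum_le_sum_of_subset_of_nonneg ?_ fun p _ _ => ?_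
          · intro p hp
            obtain ⟨ω, -, rfl⟩ := Finset.mem_image.1 hp
            simp
          · unfold prob
            positivity
      _ = (∑ a ∈ Finset.univ.image f, prob f a) * ∑ b ∈ Finset.univ.image g, prob g b := by
          rw [Finset.sum_mul_sum, Finset.sum_product]
      _ ≤ 1 := by
          refine mul_le_one₀ (sum_prob_le_one f) ?_ (sum_prob_le_one g)
          refine Finset.sum_nonneg fun a _ => ?_
          unfold prob
          positivity
  · rw [entropy_eq, entropy_eq, ← add_div, ← Finset.sum_add_distrib]
    congr 1
    refine Finset.sum_congr rfl fun ω _ => ?_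
    rw [Real.logb_mul (prob_apply_pos f ω).ne' (prob_apply_pos g ω).ne']
    ring

theorem entropy_le_of_determines (f : Ω → α) (g : Ω → β)
    (h : ∀ ω ω', f ω = f ω' → g ω = g ω') : entropy g ≤ entropy f := by
  rw [entropy_eq, entropy_eq]
  refine div_le_div_of_nonneg_right (Finset.sum_le_sum fun ω _ => neg_le_neg ?_) (by positivity)
  refine Real.logb_le_logb_of_le one_lt_two (prob_apply_pos f ω) ?_
  unfold prob
  refine div_le_div_of_nonneg_right ?_ (by positivity)
  exact_mod_cast Nat.card_le_card_of_injective
    (fun x : {ω' // f ω' = f ω} => (⟨x.1, h _ _ x.2⟩ : {ω' // g ω' = g ω}))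
    fun x y hxy => Subtype.ext (Subtype.mk.inj hxy)

theorem entropy_eq_of_determines (f : Ω → α) (g : Ω → β)
    (h : ∀ ω ω', f ω = f ω' ↔ g ω = g ω') : entropy f = entropy g :=
  (entropy_le_of_determines g f fun _ _ => (h _ _).2).antisymm
    (entropy_le_of_determines f g fun _ _ => (h _ _).1)

theorem entropy_le_logb_card [Fintype α] [Nonempty α] (f : Ω → α) :
    entropy f ≤ Real.logb 2 (Fintype.card α) := by
  classical
  have hα : (0 : ℝ) < Fintype.card α := by exact_mod_cast Fintype.card_pos
  rcases isEmpty_or_nonempty Ω with h | h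
  · rw [entropy_eq]
    simp only [Finset.univ_eq_empty, Finset.sum_empty, zero_div]
    exact Real.logb_nonneg one_lt_two (by exact_mod_cast Nat.succ_le_of_lt Fintype.card_pos)
  have hΩ : (Fintype.card Ω : ℝ) ≠ 0 := by exact_mod_cast Fintype.card_ne_zero
  refine (entropy_le_crossEntropy f (fun _ => (Fintype.card α : ℝ)⁻¹) (fun _ => inv_pos.2 hα)
    ?_).trans_eq ?_
  · rw [Finset.sum_const, nsmul_eq_mul, ← div_eq_mul_inv, div_le_one hα]
    exact_mod_cast Finset.card_le_univ _
  · simp only [Real.logb_inv, neg_neg, Finset.sum_const, Finset.card_univ, nsmul_eq_mul]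
    field_simp

/-- A bound on the entropy of a random variable that is mostly constant, as in Fano's inequality. -/
theorem entropy_option_le [Fintype α] [Nonempty α] [Nonempty Ω] (f : Ω → Option α) :
    entropy f ≤ 1 + (Nat.card {ω // f ω ≠ none} : ℝ) / (Fintype.card Ω : ℝ) *
      Real.logb 2 (Fintype.card α) := by
  classical
  have hα : (0 : ℝ) < Fintype.card α := by exact_mod_cast Fintype.card_pos
  have hΩ : (Fintype.card Ω : ℝ) ≠ 0 := by exact_mod_cast Fintype.card_ne_zero
  -- Half of the mass on `none`, the other half spread evenly: this costs one bit always, and `log₂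
  -- |α|` more when the value is not `none`.
  let q : Option α → ℝ := fun o => o.elim (2⁻¹) fun _ => (2 * Fintype.card α : ℝ)⁻¹
  have hq : ∀ o, 0 < q o := by
    rintro (_ | a) <;> simp only [q, Option.elim] <;> positivity
  refine (entropy_le_crossEntropy f q (fun _ => hq _) ?_).trans_eq ?_
  · refine (Finset.sum_le_univ_sum_of_nonneg fun o => (hq o).le).trans ?_
    rw [Fintype.sum_option]
    simp only [q, Option.elim, Finset.sum_const, Finset.card_univ, nsmul_eq_mul]
    refine le_of_eq ?_
    field_simp
    norm_num
  · have : ∀ ω, -Real.logb 2 (q (f ω)) =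
        1 + if f ω ≠ none then Real.logb 2 (Fintype.card α) else 0 := by
      intro ω
      rcases f ω with _ | a
      · simp [q, Real.logb_inv]
      · simp only [q, Option.elim, Real.logb_inv, neg_neg]
        rw [Real.logb_mul two_ne_zero hα.ne']
        simp
    simp only [this, Finset.sum_add_distrib, Finset.sum_const, Finset.card_univ, nsmul_eq_mul,
      ← Finset.sum_filter]
    rw [Nat.card_eq_fintype_card, Fintype.card_subtype]
    field_simp

/-- Fano's inequality, for the estimate `dec` of `W` from `Y`. -/
theorem fano [Fintype α] [Nonempty α] [Nonempty Ω] (W : Ω → α) (Y : Ω → β) (dec : β → α) :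
    entropy (fun ω => (W ω, Y ω)) ≤ entropy Y + (1 +
      (Nat.card {ω // dec (Y ω) ≠ W ω} : ℝ) / (Fintype.card Ω : ℝ) *
        Real.logb 2 (Fintype.card α)) := by
  classical
  -- `Z` reveals the message only when decoding fails, so `Y` and `Z` together determine `W`.
  let Z : Ω → Option α := fun ω => if dec (Y ω) ≠ W ω then some (W ω) else none
  have h1 : entropy (fun ω => (W ω, Y ω)) ≤ entropy (fun ω => (Y ω, Z ω)) := by
    refine entropy_le_of_determines _ _ fun ω ω' h => ?_
    obtain ⟨hY, hZ⟩ := Prod.mk.inj h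
    refine Prod.ext ?_ hY
    simp only [Z] at hZ
    split_ifs at hZ with h1 h2 h2
    · exact Option.some.inj hZ
    · rw [not_not] at h1 h2
      exact (h1.symm.trans (congrArg dec hY)).trans h2
  have h2 := entropy_pair_le Y Z
  have h3 := entropy_option_le Z
  have h4 : Nat.card {ω // Z ω ≠ none} = Nat.card {ω // dec (Y ω) ≠ W ω} :=
    Nat.card_congr (Equiv.subtypeEquivRight fun ω => by simp [Z])
  rw [h4] at h3
  linarith

theorem entropy_pair_of_indep (f : Ω → α) (g : Ω → β)
    (h : ∀ ω, prob (fun ω => (f ω, g ω)) (f ω, g ω) = prob f (f ω) * prob g (g ω)) :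
    entropy (fun ω => (f ω, g ω)) = entropy f + entropy g := by
  rw [entropy_eq, entropy_eq, entropy_eq, ← add_div, ← Finset.sum_add_distrib]
  congr 1
  refine Finset.sum_congr rfl fun ω _ => ?_
  rw [h, Real.logb_mul (prob_apply_pos f ω).ne' (prob_apply_pos g ω).ne']
  ring

theorem entropy_pi_le {ι : Type} [DecidableEq ι] (f : ι → Ω → α) (s : Finset ι) :
    entropy (fun ω (i : s) => f i ω) ≤ ∑ i ∈ s, entropy (f i) := by
  induction s using Finset.induction_on with
  | empty =>
    rw [Finset.sum_empty]
    refine (entropy_le_of_determines (fun _ => ()) _ fun ω ω' _ => ?_).trans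
      ((entropy_le_logb_card _).trans_eq (by simp))
    ext ⟨i, hi⟩
    simp at hi
  | insert a s ha ih =>
    rw [Finset.sum_insert ha]
    refine (entropy_le_of_determines (fun ω => (f a ω, fun i : s => f i ω)) _
      fun ω ω' h => ?_).trans ((entropy_pair_le _ _).trans (add_le_add_right ih _))
    obtain ⟨h1, h2⟩ := Prod.mk.inj h
    ext ⟨i, hi⟩
    rcases Finset.mem_insert.1 hi with rfl | hi
    · exact h1
    · exact congrFun h2 ⟨i, hi⟩

theorem entropy_nonneg (f : Ω → α) : 0 ≤ entropy f := by
  rw [entropy_eq]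
  refine div_nonneg (Finset.sum_nonneg fun ω _ => ?_) (by positivity)
  rw [neg_nonneg]
  exact Real.logb_nonpos one_lt_two (prob_apply_pos f ω).le (prob_apply_le_one f _)

/-- A random variable that is uniformly distributed on a finite group. -/
theorem entropy_addMonoidHom [AddGroup Ω] {β : Type} [AddGroup β] [Fintype β] (f : Ω →+ β)
    (hf : Function.Surjective f) : entropy f = Real.logb 2 (Fintype.card β) := by
  classical
  -- The fibers are cosets of the kernel.
  have hcard : ∀ b : β, Nat.card {ω // f ω = b} = Nat.card {ω // f ω = 0} := by
    intro b
    obtain ⟨a, rfl⟩ := hf b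
    refine Nat.card_congr
      ⟨fun x => ⟨x.1 - a, by simp [x.2]⟩, fun x => ⟨x.1 + a, by simp [x.2]⟩, ?_, ?_⟩
    · intro x; simp
    · intro x; simp
  have hsum : Fintype.card Ω = Fintype.card β * Nat.card {ω // f ω = 0} := by
    have h := Fintype.card_congr (Equiv.sigmaFiberEquiv f)
    rw [← h, Fintype.card_sigma]
    simp only [← Nat.card_eq_fintype_card, hcard, Finset.sum_const, Finset.card_univ, smul_eq_mul]
  have hΩ : (Fintype.card Ω : ℝ) ≠ 0 := by exact_mod_cast Fintype.card_ne_zero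
  have hΩ' : (Fintype.card Ω : ℝ) = Fintype.card β * Nat.card {ω // f ω = 0} := by
    exact_mod_cast hsum
  have hp : ∀ b : β, prob f b = (Fintype.card β : ℝ)⁻¹ := by
    intro b
    unfold prob
    rw [hcard, hΩ']
    rw [hΩ'] at hΩ
    have := left_ne_zero_of_mul hΩ
    have := right_ne_zero_of_mul hΩ
    field_simp
  rw [entropy_eq]
  simp only [hp, Real.logb_inv, neg_neg, Finset.sum_const, Finset.card_univ, nsmul_eq_mul]
  field_simp

end Entropy

/-! ### Independence of functions of disjoint coordinates -/

section Product

variable {ι : Type} [Fintype ι] [DecidableEq ι] {Ω : ι → Type} [∀ i, Fintype (Ω i)] {α β : Type}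

/-- Random variables that depend on disjoint sets of coordinates are independent. -/
theorem prob_pair_of_disjoint (s : Finset ι) (f : (∀ i, Ω i) → α) (g : (∀ i, Ω i) → β)
    (hf : ∀ ω ω' : ∀ i, Ω i, (∀ i ∈ s, ω i = ω' i) → f ω = f ω')
    (hg : ∀ ω ω' : ∀ i, Ω i, (∀ i ∉ s, ω i = ω' i) → g ω = g ω') (a : α) (b : β) :
    prob (fun ω => (f ω, g ω)) (a, b) = prob f a * prob g b := by
  have h1 : ∀ ω ω' : ∀ i, Ω i, f (s.piecewise ω ω') = f ω := fun ω ω' =>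
    hf _ _ fun i hi => by simp [hi]
  have h2 : ∀ ω ω' : ∀ i, Ω i, g (s.piecewise ω ω') = g ω' := fun ω ω' =>
    hg _ _ fun i hi => by simp [hi]
  have hpp : ∀ ω ω' : ∀ i, Ω i,
      s.piecewise (s.piecewise ω ω') (s.piecewise ω' ω) = ω := by
    intro ω ω'
    ext i
    by_cases hi : i ∈ s <;> simp [hi]
  -- Exchanging the coordinates outside `s` between two sample points is an involution that moves
  -- the condition on `g` to the second point.
  have e : {ω // (f ω, g ω) = (a, b)} × (∀ i, Ω i) ≃ {ω // f ω = a} × {ω // g ω = b} :=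
    { toFun := fun p => ⟨⟨s.piecewise p.1.1 p.2, (h1 _ _).trans (Prod.mk.inj p.1.2).1⟩,
        ⟨s.piecewise p.2 p.1.1, (h2 _ _).trans (Prod.mk.inj p.1.2).2⟩⟩
      invFun := fun p => ⟨⟨s.piecewise p.1.1 p.2.1,
        Prod.ext ((h1 _ _).trans p.1.2) ((h2 _ _).trans p.2.2)⟩, s.piecewise p.2.1 p.1.1⟩
      left_inv := fun p => Prod.ext (Subtype.ext (hpp _ _)) (hpp _ _)
      right_inv := fun p => Prod.ext (Subtype.ext (hpp _ _)) (Subtype.ext (hpp _ _)) }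
  have hc := Nat.card_congr e
  rw [Nat.card_prod, Nat.card_prod, Nat.card_eq_fintype_card (α := ∀ i, Ω i)] at hc
  unfold prob
  rcases eq_or_ne (Fintype.card (∀ i, Ω i) : ℝ) 0 with h0 | h0
  · rw [h0, div_zero, div_zero, zero_mul]
  · rw [div_mul_div_comm, div_eq_div_iff h0 (mul_ne_zero h0 h0), ← mul_assoc]
    congr 1
    exact_mod_cast hc

theorem entropy_pair_of_disjoint (s : Finset ι) (f : (∀ i, Ω i) → α) (g : (∀ i, Ω i) → β)
    (hf : ∀ ω ω' : ∀ i, Ω i, (∀ i ∈ s, ω i = ω' i) → f ω = f ω')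
    (hg : ∀ ω ω' : ∀ i, Ω i, (∀ i ∉ s, ω i = ω' i) → g ω = g ω') :
    entropy (fun ω => (f ω, g ω)) = entropy f + entropy g :=
  entropy_pair_of_indep f g fun _ => prob_pair_of_disjoint s f g hf hg _ _

theorem sum_entropy_le_entropy_pi (f : ι → (∀ i, Ω i) → α)
    (hf : ∀ i, ∀ ω ω' : ∀ i, Ω i, ω i = ω' i → f i ω = f i ω') (s : Finset ι) :
    ∑ i ∈ s, entropy (f i) ≤ entropy (fun ω (i : s) => f i ω) := by
  induction s using Finset.induction_on with
  | empty => simpa using entropy_nonneg _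
  | insert a s ha ih =>
    rw [Finset.sum_insert ha]
    refine (add_le_add_right ih _).trans ?_
    rw [← entropy_pair_of_disjoint {a} (f a) (fun ω (i : s) => f i ω)
      (fun ω ω' h => hf a _ _ (h a (by simp))) fun ω ω' h => ?_]
    · refine entropy_le_of_determines _ _ fun ω ω' h => Prod.ext ?_ ?_
      · exact congrFun h ⟨a, Finset.mem_insert_self _ _⟩
      · ext ⟨i, hi⟩
        exact congrFun h ⟨i, Finset.mem_insert_of_mem hi⟩
    · ext ⟨i, hi⟩
      refine hf i _ _ (h i ?_)
      rw [Finset.mem_singleton]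
      rintro rfl
      exact ha hi

end Product

/-! ### Integral duality for the assignment problem -/

section Duality

variable {ι : Type} [Fintype ι] [DecidableEq ι]

/-- If a least integral dual solution of an assignment problem is given, then an assignment is
supported on the tight edges. -/
theorem exists_perm_tight (w : ι → ι → ℕ) (u v : ι → ℤ) (huv : ∀ k i, (w k i : ℤ) ≤ u i + v k)
    (hmin : ∀ u' v' : ι → ℤ, (∀ k i, (w k i : ℤ) ≤ u' i + v' k) →
      ∑ i, u i + ∑ k, v k ≤ ∑ i, u' i + ∑ k, v' k) :
    ∃ Q : Equiv.Perm ι, ∀ i, (w (Q i) i : ℤ) = u i + v (Q i) := by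
  let t : ι → Finset ι := fun i => Finset.univ.filter fun k => (w k i : ℤ) = u i + v k
  obtain ⟨f, hf, hft⟩ := (Finset.all_card_le_biUnion_card_iff_exists_injective t).1 fun A => by
    -- Hall's condition for the tight edges: lowering `u` by one on `A` and raising `v` by one on
    -- its tight neighbors stays feasible, as an integral edge that is not tight has slack at least
    -- one. Minimality then gives `|A| ≤ |t(A)|`.
    have h := hmin (fun i => u i - if i ∈ A then 1 else 0)
      (fun k => v k + if k ∈ A.biUnion t then 1 else 0) fun k i => by
        have h1 := huv k i
        by_cases hi : i ∈ A
        · by_cases hk : k ∈ A.biUnion t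
          · simp only [hi, hk, if_true]; omega
          · have h2 : (w k i : ℤ) ≠ u i + v k := fun h2 =>
              hk (Finset.mem_biUnion.2 ⟨i, hi, by simpa [t] using h2⟩)
            simp only [hi, hk, if_true, if_false]; omega
        · simp only [hi, if_false]
          split_ifs <;> omega
    rw [Finset.sum_sub_distrib, Finset.sum_add_distrib, Finset.sum_ite_mem, Finset.sum_ite_mem,
      Finset.univ_inter, Finset.univ_inter, Finset.sum_const, Finset.sum_const] at h
    simp only [nsmul_eq_mul, mul_one] at h
    omega
  refine ⟨Equiv.ofBijective f (Finite.injective_iff_bijective.1 hf), fun i => ?_⟩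
  simpa [t] using hft i

/-- Integral linear programming duality for the assignment problem (Egerváry's theorem). -/
theorem exists_potentials (w : ι → ι → ℕ) (P : Equiv.Perm ι)
    (hP : ∀ Q : Equiv.Perm ι, ∑ i, w (Q i) i ≤ ∑ i, w (P i) i) :
    ∃ u v : ι → ℕ, (∀ k i, w k i ≤ u i + v k) ∧ ∀ i, u i + v (P i) = w (P i) i := by
  classical
  rcases isEmpty_or_nonempty ι with hι | hι
  · exact ⟨fun _ => 0, fun _ => 0, fun k => isEmptyElim k, fun i => isEmptyElim i⟩
  let val : (ι → ℤ) × (ι → ℤ) → ℤ := fun p => ∑ i, p.1 i + ∑ k, p.2 k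
  let feas : (ι → ℤ) × (ι → ℤ) → Prop := fun p => ∀ k i, (w k i : ℤ) ≤ p.1 i + p.2 k
  have hval : ∀ p, feas p → ∀ Q : Equiv.Perm ι, (∑ i, w (Q i) i : ℤ) ≤ val p := by
    intro p hp Q
    refine (Finset.sum_le_sum fun i _ => hp (Q i) i).trans_eq ?_
    rw [Finset.sum_add_distrib, Equiv.sum_comp Q p.2]
  have hnonneg : ∀ p, feas p → 0 ≤ val p := fun p hp =>
    le_trans (Finset.sum_nonneg fun i _ => by positivity) (hval p hp 1)
  have hex : ∃ N : ℕ, ∃ p, feas p ∧ val p = N := by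
    refine ⟨_, (fun i => ∑ k, (w k i : ℤ), fun _ => 0), fun k i => ?_,
      (Int.toNat_of_nonneg (hnonneg _ fun k i => ?_)).symm⟩ <;>
    · simp only [add_zero]
      exact Finset.single_le_sum (f := fun k => (w k i : ℤ)) (fun _ _ => by positivity)
        (Finset.mem_univ k)
  obtain ⟨⟨u, v⟩, hfeas, hN⟩ := Nat.find_spec hex
  obtain ⟨Q, hQ⟩ := exists_perm_tight w u v hfeas fun u' v' h' => by
    have h1 := hnonneg (u', v') h'
    have h2 := Nat.find_min' hex ⟨(u', v'), h', (Int.toNat_of_nonneg h1).symm⟩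
    change val (u, v) ≤ val (u', v')
    omega
  -- The tight `Q` has weight equal to the dual value. `P` weighs at least as much, so none of its
  -- edges has slack.
  have htight : ∀ i, u i + v (P i) = w (P i) i := by
    have h1 : (∑ i, (w (Q i) i : ℤ)) ≤ ∑ i, (w (P i) i : ℤ) := by exact_mod_cast hP Q
    have h2 : ∑ i, (w (Q i) i : ℤ) = ∑ i, u i + ∑ k, v k := by
      rw [Finset.sum_congr rfl fun i _ => hQ i, Finset.sum_add_distrib, Equiv.sum_comp Q v]
    have h3 : ∑ i, (u i + v (P i)) = ∑ i, u i + ∑ k, v k := by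
      rw [Finset.sum_add_distrib, Equiv.sum_comp P v]
    have h4 := (Finset.sum_eq_sum_iff_of_le fun i _ => hfeas (P i) i).1
      (le_antisymm (Finset.sum_le_sum fun i _ => hfeas (P i) i) (by
        change ∑ i, (u i + v (P i)) ≤ _
        omega))
    exact fun i => (h4 i (Finset.mem_univ i)).symm
  -- Moving the constant `min u` from `u` to `v` preserves all sums and makes both nonnegative: the
  -- constraint at `i₀` gives `v k + u i₀ ≥ w k i₀ ≥ 0`.
  obtain ⟨i₀, hi₀⟩ := Finite.exists_min u
  have hu : ∀ i, 0 ≤ u i - u i₀ := fun i => sub_nonneg.2 (hi₀ i)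
  have hv : ∀ k, 0 ≤ v k + u i₀ := fun k => by
    have := hfeas k i₀
    simp only at this
    omega
  refine ⟨fun i => (u i - u i₀).toNat, fun k => (v k + u i₀).toNat, fun k i => ?_, fun i => ?_⟩
  · have := hfeas k i
    have := hu i
    have := hv k
    simp only at *
    omega
  · have := htight i
    have := hu i
    have := hv (P i)
    simp only at *
    omega

end Duality

/-! ### Acyclic level graphs are invertible -/

section Acyclic

variable {K : ℕ} {N : Fin K → Fin K → ℕ} {P : Equiv.Perm (Fin K)}

theorem levelGraph_adj {x : InLevel N P} {y : OutLevel N P} :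
    (levelGraph N P).Adj (Sum.inl x) (Sum.inr y) ↔ CrossLink N P x y.1 := by
  rw [levelGraph, SimpleGraph.fromRel_adj]
  constructor
  · rintro ⟨-, ⟨x', y', hx, hy, h⟩ | ⟨x', y', hx, hy, h⟩⟩
    · rwa [Sum.inl_injective hx, Sum.inr_injective hy]
    · exact absurd hx Sum.inr_ne_inl
  · exact fun h => ⟨Sum.inl_ne_inr, Or.inl ⟨x, y, rfl, rfl, h⟩⟩

/-- An edge weight that is positive belongs to a nontrivial cycle. -/
theorem apply_ne_of_lt_edgeWeight {i : Fin K} {b : ℕ} (h : b < edgeWeight N P i) : P i ≠ i := by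
  intro h'
  simp [edgeWeight, h'] at h

theorem edgeWeight_of_ne {i : Fin K} (h : P i ≠ i) : edgeWeight N P i = N (P i) i := by
  simp [edgeWeight, h]

theorem InLevel.lt (x : InLevel N P) : (x.2 : ℕ) < N (P x.1) x.1 :=
  x.2.2.trans_eq (edgeWeight_of_ne (apply_ne_of_lt_edgeWeight x.2.2))

theorem InLevel.crossLink (x : InLevel N P) :
    CrossLink N P x (P x.1, N (P x.1) x.1 - 1 - x.2) := by
  refine ⟨(apply_ne_of_lt_edgeWeight x.2.2).symm, ?_⟩
  have := x.lt
  simp only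
  omega

/-- The level at which the receiver of the cyclic predecessor observes an input level. -/
def InLevel.target (x : InLevel N P) : OutLevel N P :=
  ⟨(P x.1, N (P x.1) x.1 - 1 - x.2), x, x.crossLink⟩

theorem InLevel.target_injective : Function.Injective (InLevel.target (N := N) (P := P)) := by
  rintro ⟨i, b⟩ ⟨j, c⟩ h
  have h1 := Prod.mk.inj (Subtype.mk.inj h)
  obtain rfl : i = j := P.injective h1.1
  have hb := InLevel.lt ⟨i, b⟩
  have hc := InLevel.lt ⟨i, c⟩
  have h2 := h1.2
  simp only at h2 hb hc
  congr 1
  exact Fin.ext (by omega)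

instance : Finite (OutLevel N P) := by
  refine Finite.of_injective
    (fun y : OutLevel N P => ((y.2.choose, y.1.1) : InLevel N P × Fin K)) fun y z h => ?_
  obtain ⟨h1, h2⟩ := Prod.mk.inj h
  have hy := y.2.choose_spec.2
  have hz := z.2.choose_spec.2
  rw [h1, h2] at hy
  exact Subtype.ext (Prod.ext h2 (by omega))

/-- If the target of each input level in `S` has another neighbor in `S`, then an acyclic graph has
arbitrarily long paths that start in `S`. -/
theorem exists_isPath_of_forall_exists_crossLink (hG : (levelGraph N P).IsAcyclic)
    (S : Set (InLevel N P))
    (hS : ∀ x ∈ S, ∃ x' ∈ S, x' ≠ x ∧ CrossLink N P x' x.target.1) {x₀ : InLevel N P}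
    (hx₀ : x₀ ∈ S) (l : ℕ) :
    ∃ x ∈ S, ∃ p : (levelGraph N P).Walk (Sum.inl x₀) (Sum.inl x), p.IsPath ∧ l ≤ p.length ∧
      p.penultimate ≠ Sum.inr x.target := by
  induction l with
  | zero => exact ⟨x₀, hx₀, SimpleGraph.Walk.nil, by simp, by simp, by simp⟩
  | succ l ih =>
    obtain ⟨x, hx, p, hp, hl, hne⟩ := ih
    have hadj : (levelGraph N P).Adj (Sum.inl x) (Sum.inr x.target) :=
      levelGraph_adj.2 x.crossLink
    -- In an acyclic graph, a neighbor of the end of a path that lies on the path is its penultimate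
    -- vertex; this is what the last clause of the induction hypothesis excludes.
    have h1 : Sum.inr x.target ∉ p.support := fun h =>
      hne (hG.eq_penultimate_of_adj_end hp hadj h).symm
    have hq := hp.concat h1 hadj
    obtain ⟨x', hx', hxx', hc⟩ := hS x hx
    have hadj' : (levelGraph N P).Adj (Sum.inr x.target) (Sum.inl x') :=
      (levelGraph_adj.2 hc).symm
    have h2 : Sum.inl x' ∉ (p.concat hadj).support := fun h => by
      have := hG.eq_penultimate_of_adj_end hq hadj' h
      rw [SimpleGraph.Walk.penultimate_concat] at this
      exact hxx' (Sum.inl_injective this)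
    refine ⟨x', hx', (p.concat hadj).concat hadj', hq.concat h2 hadj', ?_, ?_⟩
    · simp only [SimpleGraph.Walk.length_concat]
      omega
    · rw [SimpleGraph.Walk.penultimate_concat]
      exact fun h => hxx' (InLevel.target_injective (Sum.inr_injective h)).symm

theorem shift_apply (s : ℕ) (x : Bits) (l : ℕ) : shift s x l = if l < s then x (s - 1 - l) else 0 :=
  rfl

theorem shift_sub (s : ℕ) (x y : Bits) : shift s (x - y) = shift s x - shift s y := by
  ext l
  simp only [shift_apply, Pi.sub_apply]
  split_ifs <;> simp

theorem participatingInput_sub (X Y : InLevel N P → ZMod 2) (i : Fin K) :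
    participatingInput N P (X - Y) i = participatingInput N P X i - participatingInput N P Y i := by
  ext b
  simp only [participatingInput, Pi.sub_apply]
  split_ifs <;> simp

theorem participatingOutput_sub (X Y : InLevel N P → ZMod 2) :
    participatingOutput N P (X - Y) = participatingOutput N P X - participatingOutput N P Y := by
  ext k : 1
  simp only [participatingOutput, participatingInput_sub, shift_sub, Finset.sum_sub_distrib,
    Pi.sub_apply]

theorem invertibleUnder_of_isAcyclic (hG : (levelGraph N P).IsAcyclic) : InvertibleUnder N P := by
  intro X X' hXX'
  by_contra hne
  obtain ⟨D, hD⟩ : ∃ D, D = X - X' := ⟨_, rfl⟩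
  have hout : participatingOutput N P D = 0 := by
    rw [hD, participatingOutput_sub, hXX', sub_self]
  obtain ⟨x₀, hx₀⟩ : ∃ x, D x ≠ 0 := by
    by_contra! h
    exact hne (sub_eq_zero.1 (hD.symm.trans (funext h)))
  -- If `x` were the only nonzero bit linked to its target, the output there would be `D x`, yet the
  -- output vanishes.
  have hS : ∀ x ∈ {x | D x ≠ 0}, ∃ x' ∈ {x | D x ≠ 0}, x' ≠ x ∧ CrossLink N P x' x.target.1 := by
    intro x hx
    by_contra! hcon
    refine hx ?_
    have h := congrFun (congrFun hout (P x.1)) (N (P x.1) x.1 - 1 - x.2)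
    simp only [participatingOutput, Finset.sum_apply, Pi.zero_apply] at h
    have hlt := x.lt
    have hi : x.1 ∈ Finset.univ.erase (P x.1) := by
      simpa using (apply_ne_of_lt_edgeWeight x.2.2).symm
    rw [Finset.sum_eq_single_of_mem x.1 hi] at h
    · rw [shift_apply, if_pos (by omega), participatingInput, dif_pos (by have := x.2.2; omega)] at h
      convert h using 2
      refine Sigma.ext rfl (heq_of_eq (Fin.ext ?_))
      simp only
      omega
    · intro j hj hjx
      rw [shift_apply]
      split_ifs with hl
      · rw [participatingInput]
        split_ifs with hb
        · by_contra hDj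
          refine hcon ⟨j, ⟨_, hb⟩⟩ hDj (fun h => hjx (congrArg Sigma.fst h))
            ⟨(Finset.mem_erase.1 hj).1, ?_⟩
          simp only [InLevel.target]
          omega
        · rfl
      · rfl
  have := Fintype.ofFinite (InLevel N P ⊕ OutLevel N P)
  obtain ⟨x, -, p, hp, hl, -⟩ := exists_isPath_of_forall_exists_crossLink hG _ hS hx₀
    (Fintype.card (InLevel N P ⊕ OutLevel N P))
  exact absurd hp.length_lt (not_lt.2 hl)

end Acyclic

/-! ### Interference in one sub-channel -/

section SubChannel

variable {K : ℕ}

/-- The strongest interference that user `i` causes. -/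
def causedLevel (N : Fin K → Fin K → ℕ) (i : Fin K) : ℕ :=
  (Finset.univ.erase i).sup fun j => N j i

theorem le_causedLevel (N : Fin K → Fin K → ℕ) {i k : Fin K} (h : k ≠ i) :
    N k i ≤ causedLevel N i :=
  Finset.le_sup (f := fun j => N j i) (by simpa using h)

/-- The interference at Receiver `k`. -/
def interference (N : Fin K → Fin K → ℕ) (x : Fin K → Bits) (k : Fin K) : Bits :=
  ∑ i ∈ Finset.univ.erase k, shift (N k i) (x i)

theorem output_eq (N : Fin K → Fin K → ℕ) (x : Fin K → Bits) (k : Fin K) :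
    output N x k = shift (N k k) (x k) + interference N x k :=
  (Finset.add_sum_erase _ _ (Finset.mem_univ k)).symm

theorem interference_apply (N : Fin K → Fin K → ℕ) (x : Fin K → Bits) (k : Fin K) (l : ℕ) :
    interference N x k l = ∑ i ∈ Finset.univ.erase k, shift (N k i) (x i) l :=
  Finset.sum_apply _ _ _

theorem interference_sub (N : Fin K → Fin K → ℕ) (x y : Fin K → Bits) (k : Fin K) :
    interference N (x - y) k = interference N x k - interference N y k := by
  simp only [interference, Pi.sub_apply, shift_sub, Finset.sum_sub_distrib]

theorem interference_congr (N : Fin K → Fin K → ℕ) {x x' : Fin K → Bits} {k : Fin K}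
    (h : ∀ i, i ≠ k → x i = x' i) : interference N x k = interference N x' k :=
  Finset.sum_congr rfl fun i hi => by rw [h i (Finset.ne_of_mem_erase hi)]

theorem edgeWeight_le_causedLevel (N : Fin K → Fin K → ℕ) (P : Equiv.Perm (Fin K)) (i : Fin K) :
    edgeWeight N P i ≤ causedLevel N i := by
  unfold edgeWeight
  split_ifs with h
  · exact Nat.zero_le _
  · exact le_causedLevel N h

theorem TINOptimal.add_le {N : Fin K → Fin K → ℕ} (h : TINOptimal N) {i k : Fin K} (hk : k ≠ i) :
    causedLevel N i + N i k ≤ N i i :=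
  (add_le_add_right (Finset.le_sup (f := fun k => N i k) (by simpa using hk)) _).trans (h i)

theorem TINOptimal.causedLevel_le {N : Fin K → Fin K → ℕ} (h : TINOptimal N) (i : Fin K) :
    causedLevel N i ≤ N i i :=
  (Nat.le_add_right _ _).trans (h i)

/-- In an invertible sub-channel, the interfering bits are determined by the interference and the
bits that do not participate. -/
theorem InvertibleUnder.eq_of_interference_eq {N : Fin K → Fin K → ℕ} {P : Equiv.Perm (Fin K)}
    (hP : InvertibleUnder N P) {x x' : Fin K → Bits}
    (hV : ∀ k, interference N x k = interference N x' k)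
    (hD : ∀ i b, edgeWeight N P i ≤ b → b < causedLevel N i → x i b = x' i b) (i : Fin K) (b : ℕ)
    (hb : b < causedLevel N i) : x i b = x' i b := by
  let X : InLevel N P → ZMod 2 := fun y => (x - x') y.1 y.2
  have hX : X = 0 := by
    apply hP
    have h0 : participatingOutput N P (0 : InLevel N P → ZMod 2) = 0 := by
      rw [← sub_self (0 : InLevel N P → ZMod 2), participatingOutput_sub, sub_self]
    rw [h0]
    ext k l
    rw [Pi.zero_apply, Pi.zero_apply]
    have h1 : interference N (x - x') k l = 0 := by
      rw [interference_sub, hV, sub_self, Pi.zero_apply]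
    -- Dropping the other bits of `x - x'` changes nothing: below `causedLevel` they agree by `hD`,
    -- and beyond it no other receiver sees them.
    rw [← h1, interference_apply, participatingOutput, Finset.sum_apply]
    refine Finset.sum_congr rfl fun j hj => ?_
    rw [shift_apply, shift_apply]
    split_ifs with hl
    · rw [participatingInput]
      split_ifs with hw
      · rfl
      · have := le_causedLevel N (Finset.ne_of_mem_erase hj).symm
        rw [Pi.sub_apply, Pi.sub_apply, hD j _ (not_lt.1 hw) (by omega), sub_self]
    · rfl
  rcases lt_or_ge b (edgeWeight N P i) with h | h
  · exact sub_eq_zero.1 (congrFun hX ⟨i, ⟨b, h⟩⟩)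
  · exact hD i b h hb

/-- Under TIN optimality, the interfering bits of a user arrive at its own receiver above the
interference; the output has few other levels. -/
theorem TINOptimal.output_eq_of_eq {N : Fin K → Fin K → ℕ} (h : TINOptimal N) (k : Fin K)
    {x x' : Fin K → Bits} (hG : ∀ b, b < causedLevel N k → x k b = x' k b)
    (hY : ∀ l, l < N k k - causedLevel N k → output N x k l = output N x' k l) :
    output N x k = output N x' k := by
  ext l
  rcases lt_or_ge l (N k k - causedLevel N k) with hl | hl
  · exact hY l hl
  · have hI : ∀ z : Fin K → Bits, interference N z k l = 0 := fun z => by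
      rw [interference_apply]
      refine Finset.sum_eq_zero fun i hi => ?_
      have := h.add_le (Finset.ne_of_mem_erase hi)
      rw [shift_apply, if_neg (by omega)]
    rw [output_eq, output_eq, Pi.add_apply, Pi.add_apply, hI, hI, shift_apply, shift_apply]
    split_ifs with h1
    · rw [hG _ (by omega)]
    · rfl

end SubChannel

/-! ### The converse: an entropy bound on the sum-rate -/

section Converse

variable {K M : ℕ}

theorem logb_card_bits (ι : Type) [Fintype ι] [DecidableEq ι] :
    Real.logb 2 (Fintype.card (ι → ZMod 2)) = Fintype.card ι := by
  rw [Fintype.card_fun, ZMod.card, Nat.cast_pow, Real.logb_pow]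
  simp

/-- The finitely many messages of all users. -/
abbrev Messages (T : ℕ) (R : Fin K → ℝ) : Type := (i : Fin K) → Fin (numMessages T (R i))

theorem numMessages_pos (T : ℕ) (R : ℝ) : 0 < numMessages T R :=
  Nat.ceil_pos.2 (Real.rpow_pos_of_pos two_pos _)

instance (T : ℕ) (R : ℝ) : Nonempty (Fin (numMessages T R)) := ⟨⟨0, numMessages_pos T R⟩⟩

instance (T : ℕ) (R : Fin K → ℝ) : Nonempty (Messages T R) := ⟨fun _ => Classical.arbitrary _⟩

/-- The entropy of a message. -/
theorem entropy_message (T : ℕ) (R : Fin K → ℝ) (k : Fin K) :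
    entropy (fun w : Messages T R => w k) = Real.logb 2 (numMessages T (R k)) := by
  have : ∀ k, NeZero (numMessages T (R k)) := fun k => ⟨(numMessages_pos T (R k)).ne'⟩
  have h := entropy_addMonoidHom (Pi.evalAddMonoidHom (fun i => Fin (numMessages T (R i))) k)
    (Function.surjective_eval k)
  rwa [Fintype.card_fin] at h

theorem mul_le_logb_numMessages (T : ℕ) (R : ℝ) : T * R ≤ Real.logb 2 (numMessages T R) := by
  rw [Real.le_logb_iff_rpow_le one_lt_two (by exact_mod_cast numMessages_pos T R)]
  exact Nat.le_ceil _

variable {T : ℕ} {R : Fin K → ℝ} (c : Code K M T R) (n : Fin M → Fin K → Fin K → ℕ)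

/-- The channel inputs for given messages, in a given channel use and sub-channel. -/
def Code.input (w : Messages T R) (t : Fin T) (m : Fin M) (i : Fin K) : Bits := c.enc i (w i) t m

/-- The interference in all channel uses and sub-channels. -/
def Code.interf (k : Fin K) (w : Messages T R) : Fin T → Fin M → Bits :=
  fun t m => interference (n m) (c.input w t m) k

/-- The bits of user `k` that cause interference. -/
def Code.interfering (k : Fin K) (w : Messages T R) : Fin T → Fin M → Bits :=
  fun t m b => if b < causedLevel (n m) k then c.input w t m k b else 0

theorem Code.received_eq (w : Messages T R) (k : Fin K) (t : Fin T) (m : Fin M) :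
    c.received n w k t m = shift (n m k k) (c.input w t m k) + c.interf n k w t m :=
  output_eq _ _ _

/-- Given its own message, Receiver `k` can subtract its own signal and is left with the
interference, which is independent of that message. -/
theorem Code.entropy_message_received (k : Fin K) :
    Real.logb 2 (numMessages T (R k)) + entropy (c.interf n k) ≤
      entropy (fun w => (w k, c.received n w k)) := by
  rw [← entropy_message, ← entropy_pair_of_disjoint {k} (fun w : Messages T R => w k)
    (c.interf n k) (fun w w' h => h k (by simp)) fun w w' h => ?_]
  · refine entropy_le_of_determines _ _ fun w w' h => ?_
    obtain ⟨h1, h2⟩ := Prod.mk.inj h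
    refine Prod.ext h1 ?_
    ext t m : 2
    have h3 := congrFun (congrFun h2 t) m
    rw [c.received_eq, c.received_eq, Code.input, Code.input, h1] at h3
    exact add_left_cancel h3
  · ext t m : 2
    exact interference_congr _ fun i hi => by rw [Code.input, Code.input, h i (by simpa using hi)]

theorem Code.fano (k : Fin K) :
    (1 - c.errorProb n k) * (T * R k) ≤
      entropy (fun w => c.received n w k) - entropy (c.interf n k) + 1 := by
  have h1 := c.entropy_message_received n k
  have h2 := ADT.fano (fun w : Messages T R => w k) (fun w => c.received n w k) (c.dec k)
  have h3 : c.errorProb n k = (Nat.card {w : Messages T R // c.dec k (c.received n w k) ≠ w k} : ℝ) /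
      (Fintype.card (Messages T R) : ℝ) := by
    rw [← Nat.card_eq_fintype_card]
    rfl
  rw [← h3, Fintype.card_fin] at h2
  have h4 : c.errorProb n k ≤ 1 := by
    refine div_le_one_of_le₀ ?_ (by positivity)
    exact_mod_cast Nat.card_le_card_of_injective _ Subtype.val_injective
  have h5 := mul_le_mul_of_nonneg_left (mul_le_logb_numMessages T (R k)) (sub_nonneg.2 h4)
  linarith

theorem Code.entropy_received_le (hTIN : ∀ m, TINOptimal (n m)) (k : Fin K) :
    entropy (fun w => c.received n w k) ≤ entropy (c.interfering n k) +
      T * ∑ m, ((n m k k : ℝ) - causedLevel (n m) k) := by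
  -- The received levels that are not fixed by the interfering bits of user `k`.
  let low : Messages T R → (Fin T × (Σ m, Fin (n m k k - causedLevel (n m) k))) → ZMod 2 :=
    fun w p => c.received n w k p.1 p.2.1 p.2.2
  have h1 : entropy low ≤ T * ∑ m, ((n m k k : ℝ) - causedLevel (n m) k) := by
    refine (entropy_le_logb_card low).trans_eq ?_
    rw [logb_card_bits, Fintype.card_prod, Fintype.card_sigma]
    simp only [Fintype.card_fin]
    push_cast
    congr 1
    exact Finset.sum_congr rfl fun m _ => Nat.cast_sub ((hTIN m).causedLevel_le k)
  refine le_trans ?_ ((entropy_pair_le (c.interfering n k) low).trans (add_le_add_right h1 _))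
  refine entropy_le_of_determines _ _ fun w w' h => ?_
  obtain ⟨hG, hY⟩ := Prod.mk.inj h
  ext t m : 2
  refine (hTIN m).output_eq_of_eq k (fun b hb => ?_) fun l hl => congrFun hY (t, ⟨m, ⟨l, hl⟩⟩)
  have := congrFun (congrFun (congrFun hG t) m) b
  simp only [Code.interfering, if_pos hb] at this
  exact this

theorem Code.sum_entropy_interfering_le (P : Fin M → Equiv.Perm (Fin K))
    (hP : ∀ m, InvertibleUnder (n m) (P m)) :
    ∑ k, entropy (c.interfering n k) ≤ ∑ k, entropy (c.interf n k) +
      T * ∑ m, ∑ k, ((causedLevel (n m) k : ℝ) - edgeWeight (n m) (P m) k) := by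
  -- The interfering bits that do not participate; with all interferences they determine every
  -- interfering bit.
  let rest : Messages T R → (Fin T × (Σ m, Σ k, Fin (causedLevel (n m) k -
      edgeWeight (n m) (P m) k))) → ZMod 2 :=
    fun w p => c.input w p.1 p.2.1 p.2.2.1 (edgeWeight (n p.2.1) (P p.2.1) p.2.2.1 + p.2.2.2)
  have h1 : entropy rest ≤
      T * ∑ m, ∑ k, ((causedLevel (n m) k : ℝ) - edgeWeight (n m) (P m) k) := by
    refine (entropy_le_logb_card rest).trans_eq ?_
    rw [logb_card_bits, Fintype.card_prod, Fintype.card_sigma]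
    simp only [Fintype.card_fin, Fintype.card_sigma]
    push_cast
    congr 1
    exact Finset.sum_congr rfl fun m _ => Finset.sum_congr rfl fun k _ =>
      Nat.cast_sub (edgeWeight_le_causedLevel _ _ _)
  refine (sum_entropy_le_entropy_pi (c.interfering n) (fun k w w' h => ?_) Finset.univ).trans ?_
  · ext t m b
    change (if b < causedLevel (n m) k then c.enc k (w k) t m b else 0) = _
    rw [h]
    rfl
  refine le_trans ?_ (add_le_add (entropy_pi_le (c.interf n) Finset.univ) h1)
  refine le_trans ?_ (entropy_pair_le _ _)
  refine entropy_le_of_determines _ _ fun w w' h => ?_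
  obtain ⟨hV, hD⟩ := Prod.mk.inj h
  ext ⟨k, hk⟩ t m b
  simp only [Code.interfering]
  split_ifs with hb
  · refine (hP m).eq_of_interference_eq (x := c.input w t m) (x' := c.input w' t m)
      (fun k => ?_) (fun i b h1 h2 => ?_) k b hb
    · exact congrFun (congrFun (congrFun hV ⟨k, Finset.mem_univ k⟩) t) m
    · have := congrFun hD (t, ⟨m, ⟨i, ⟨b - edgeWeight (n m) (P m) i, by omega⟩⟩⟩)
      simpa only [rest, Nat.add_sub_of_le h1] using this
  · rfl

/-- In the sum over users the entropies of interference and of interfering bits cancel, as do the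
terms `causedLevel`. The summand `K` collects one bit per user from Fano. -/
theorem Code.sum_rate_le (hTIN : ∀ m, TINOptimal (n m)) (P : Fin M → Equiv.Perm (Fin K))
    (hP : ∀ m, InvertibleUnder (n m) (P m)) :
    ∑ k, (1 - c.errorProb n k) * (T * R k) ≤
      T * ∑ m, (cyclicPartitionBound (n m) (P m) : ℝ) + K := by
  have h1 := Finset.sum_le_sum fun k (_ : k ∈ Finset.univ) => c.fano n k
  have h2 := Finset.sum_le_sum fun k (_ : k ∈ Finset.univ) => c.entropy_received_le n hTIN k
  have h3 := c.sum_entropy_interfering_le n P hP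
  rw [Finset.sum_add_distrib, Finset.sum_sub_distrib, Finset.sum_const, Finset.card_univ,
    Fintype.card_fin, nsmul_eq_mul, mul_one] at h1
  rw [Finset.sum_add_distrib, ← Finset.mul_sum, Finset.sum_comm] at h2
  have h4 : (T : ℝ) * ∑ m, (cyclicPartitionBound (n m) (P m) : ℝ) =
      T * ∑ m, ∑ k, ((n m k k : ℝ) - causedLevel (n m) k) +
      T * ∑ m, ∑ k, ((causedLevel (n m) k : ℝ) - edgeWeight (n m) (P m) k) := by
    rw [← mul_add, ← Finset.sum_add_distrib]
    congr 1
    refine Finset.sum_congr rfl fun m _ => ?_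
    rw [← Finset.sum_add_distrib, cyclicPartitionBound]
    push_cast
    rw [← Finset.sum_sub_distrib]
    exact Finset.sum_congr rfl fun k _ => by ring
  linarith

theorem sum_le_of_mem_capacityRegion {n : Fin M → Fin K → Fin K → ℕ}
    (hTIN : ∀ m, TINOptimal (n m)) (P : Fin M → Equiv.Perm (Fin K))
    (hP : ∀ m, InvertibleUnder (n m) (P m)) {R : Fin K → ℝ} (hR : R ∈ capacityRegion n) :
    ∑ k, R k ≤ ∑ m, (cyclicPartitionBound (n m) (P m) : ℝ) := by
  have hclosed : IsClosed {R : Fin K → ℝ | ∑ k, R k ≤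
      ∑ m, (cyclicPartitionBound (n m) (P m) : ℝ)} :=
    isClosed_le (by fun_prop) continuous_const
  refine closure_minimal ?_ hclosed hR
  rintro R ⟨-, c, hc⟩
  have h1 : Tendsto (fun T => ∑ k, (1 - (c T).errorProb n k) * R k) atTop (𝓝 (∑ k, R k)) := by
    refine tendsto_finsetSum _ fun k _ => ?_
    simpa using ((hc k).const_sub 1).mul_const (R k)
  have h2 : Tendsto (fun T : ℕ => ∑ m, (cyclicPartitionBound (n m) (P m) : ℝ) + (K : ℝ) / T) atTop
      (𝓝 (∑ m, (cyclicPartitionBound (n m) (P m) : ℝ))) := by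
    simpa using (tendsto_const_div_atTop_nhds_zero_nat (K : ℝ)).const_add
      (∑ m, (cyclicPartitionBound (n m) (P m) : ℝ))
  refine le_of_tendsto_of_tendsto h1 h2 ((eventually_gt_atTop 0).mono fun T hT => ?_)
  have hT' : (0 : ℝ) < T := by exact_mod_cast hT
  have h3 := (c T).sum_rate_le n hTIN P hP
  refine le_of_mul_le_mul_left ?_ hT'
  rw [Finset.mul_sum, mul_add, mul_div_cancel₀ _ hT'.ne']
  refine le_trans (le_of_eq (Finset.sum_congr rfl fun k _ => ?_)) h3
  ring

end Converse

/-! ### Dual potentials of an optimal partition -/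

section Potentials

variable {K : ℕ} {N : Fin K → Fin K → ℕ} {P : Equiv.Perm (Fin K)}

theorem OptimalPartition.exists_potentials (hP : OptimalPartition N P) :
    ∃ u v : Fin K → ℕ, (∀ k i, i ≠ k → N k i ≤ u i + v k) ∧
      ∀ i, u i + v (P i) = edgeWeight N P i := by
  -- A zero diagonal gives trivial cycles no weight, so that assignments weigh the same as cyclic
  -- partitions.
  obtain ⟨u, v, h1, h2⟩ := ADT.exists_potentials (fun k i => if k = i then 0 else N k i) P
    fun Q => by
      have h := hP Q
      have hQ : ∀ Q, ∑ k, (edgeWeight N Q k : ℤ) = ((∑ k, edgeWeight N Q k : ℕ) : ℤ) := by simp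
      rw [cyclicPartitionBound, cyclicPartitionBound, hQ, hQ] at h
      change ∑ k, edgeWeight N Q k ≤ ∑ k, edgeWeight N P k
      omega
  refine ⟨u, v, fun k i hki => ?_, h2⟩
  have := h1 k i
  rwa [if_neg hki.symm] at this

/-- Tightness on the edge leaving `i` bounds `u i` by the interference that `i` causes; on the edge
entering `i` it bounds `v i` by an interference that `i` suffers, or makes it zero in a trivial
cycle. -/
theorem TINOptimal.potential_add_le (hN : TINOptimal N) {u v : Fin K → ℕ}
    (huv : ∀ i, u i + v (P i) = edgeWeight N P i) (i : Fin K) : u i + v i ≤ N i i := by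
  have h1 : u i ≤ causedLevel N i :=
    le_trans (by have := huv i; omega) (edgeWeight_le_causedLevel N P i)
  obtain ⟨j, rfl⟩ := P.surjective i
  have h2 := huv j
  rcases eq_or_ne (P j) j with h | h
  · have := hN.causedLevel_le (P j)
    rw [edgeWeight, if_pos h] at h2
    omega
  · have := hN.add_le h.symm
    rw [edgeWeight_of_ne h] at h2
    omega

theorem sum_sub_potentials {u v : Fin K → ℕ} (hle : ∀ i, u i + v i ≤ N i i)
    (huv : ∀ i, u i + v (P i) = edgeWeight N P i) :
    ∑ i, ((N i i - u i - v i : ℕ) : ℝ) = cyclicPartitionBound N P := by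
  have h1 : ∀ i, ((N i i - u i - v i : ℕ) : ℝ) = N i i - (u i + v i) := fun i => by
    rw [Nat.sub_sub, Nat.cast_sub (hle i), Nat.cast_add]
  have h2 : ∑ i, (v i : ℝ) = ∑ i, (v (P i) : ℝ) := (Equiv.sum_comp P fun i => (v i : ℝ)).symm
  simp only [h1, cyclicPartitionBound, ← huv]
  push_cast
  rw [Finset.sum_sub_distrib, Finset.sum_add_distrib, Finset.sum_add_distrib, h2]

end Potentials

/-! ### The rate of TIN under power control -/

section Rate

variable {K : ℕ} (N : Fin K → Fin K → ℕ) (r : Fin K → ℕ)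

theorem shift_add (s : ℕ) (x y : Bits) : shift s (x + y) = shift s x + shift s y := by
  ext l
  simp only [shift_apply, Pi.add_apply]
  split_ifs <;> simp

theorem tinInput_apply (U : Fin K → Fin (maxLevel N) → ZMod 2) (j : Fin K) (b : ℕ) :
    tinInput N r U j b =
      if h : b < maxLevel N then (if r j ≤ b then U j ⟨b, h⟩ else 0) else 0 := rfl

theorem tinInput_add (U V : Fin K → Fin (maxLevel N) → ZMod 2) :
    tinInput N r (U + V) = tinInput N r U + tinInput N r V := by
  ext j b
  simp only [tinInput_apply, Pi.add_apply]
  split_ifs <;> simp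

theorem tinInput_congr {U V : Fin K → Fin (maxLevel N) → ZMod 2} {j : Fin K} (h : U j = V j) :
    tinInput N r U j = tinInput N r V j := by
  ext b
  simp only [tinInput_apply, h]

theorem le_maxLevel (k i : Fin K) : N k i ≤ maxLevel N :=
  (Finset.le_sup (f := N k) (Finset.mem_univ i)).trans
    (Finset.le_sup (f := fun k => Finset.univ.sup (N k)) (Finset.mem_univ k))

/-- The lowest `d` levels of the signal from the transmitters in `s` at Receiver `k`. -/
def lowLevels (s : Finset (Fin K)) (k : Fin K) (d : ℕ) :
    (Fin K → Fin (maxLevel N) → ZMod 2) →+ (Fin d → ZMod 2) :=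
  AddMonoidHom.mk' (fun U l => (∑ i ∈ s, shift (N k i) (tinInput N r U i)) l) fun U V => by
    ext l
    simp only [tinInput_add, Pi.add_apply, shift_add, Finset.sum_add_distrib]

theorem lowLevels_apply (s : Finset (Fin K)) (k : Fin K) (d : ℕ)
    (U : Fin K → Fin (maxLevel N) → ZMod 2) (l : Fin d) :
    lowLevels N r s k d U l = (∑ i ∈ s, shift (N k i) (tinInput N r U i)) l := rfl

theorem lowLevels_surjective {s : Finset (Fin K)} {k : Fin K} {d : ℕ}
    (h : d = 0 ∨ ∃ j ∈ s, d + r j ≤ N k j) : Function.Surjective (lowLevels N r s k d) := by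
  rcases h with rfl | ⟨j, hj, hd⟩
  · exact fun z => ⟨0, Subsingleton.elim _ _⟩
  intro z
  -- Transmitter `j` alone produces `z`: its bit `b` arrives at level `N k j - 1 - b`, and the bits
  -- for the lowest `d` levels survive the power reduction.
  refine ⟨Pi.single j fun b => if h : N k j - 1 - b < d then z ⟨_, h⟩ else 0, ?_⟩
  ext l
  have hl := l.2
  have hmax := le_maxLevel N k j
  rw [lowLevels_apply, Finset.sum_apply, Finset.sum_eq_single_of_mem j hj]
  · rw [shift_apply, if_pos (by omega), tinInput_apply, dif_pos (by omega), if_pos (by omega),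
      Pi.single_eq_same, dif_pos (by simp only; omega)]
    congr 1
    ext
    simp only
    omega
  · intro i _ hij
    rw [shift_apply, tinInput_apply, Pi.single_eq_of_ne hij]
    simp

/-- The signal of power controlled transmitters is uniform on the levels that it reaches. -/
theorem entropy_signal {s : Finset (Fin K)} {k : Fin K} {d : ℕ}
    (h : d = 0 ∨ ∃ j ∈ s, d + r j ≤ N k j) (hs : ∀ i ∈ s, N k i ≤ r i + d) :
    entropy (fun U => ∑ i ∈ s, shift (N k i) (tinInput N r U i)) = d := by
  have h1 := entropy_addMonoidHom (lowLevels N r s k d) (lowLevels_surjective N r h)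
  rw [logb_card_bits, Fintype.card_fin] at h1
  rw [← h1]
  refine entropy_eq_of_determines _ _ fun U V => ⟨fun hUV => ?_, fun hUV => ?_⟩
  · ext l
    rw [lowLevels_apply, lowLevels_apply, hUV]
  · ext l
    rcases lt_or_ge l d with hl | hl
    · exact congrFun hUV ⟨l, hl⟩
    · have hz : ∀ W, (∑ i ∈ s, shift (N k i) (tinInput N r W i)) l = 0 := fun W => by
        rw [Finset.sum_apply]
        refine Finset.sum_eq_zero fun i hi => ?_
        have := hs i hi
        rw [shift_apply]
        split_ifs
        · rw [tinInput_apply]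
          split_ifs
          · omega
          · rfl
          · rfl
        · rfl
      rw [hz, hz]

/-- `I(X; Y) = H(Y) - H(V)`, where the output fills `N i i - r i` levels. The hypothesis `htight`
makes the interference fill all its `v i` levels, so that the rate is exact. -/
theorem tinRate_eq {v : Fin K → ℕ} {i : Fin K}
    (h : ∀ j, j ≠ i → N i j ≤ r j + v i) (hle : r i + v i ≤ N i i)
    (htight : v i = 0 ∨ ∃ j, j ≠ i ∧ v i + r j ≤ N i j) :
    tinRate N r i = (N i i - r i - v i : ℕ) := by
  have hY : entropy (fun U => output N (tinInput N r U) i) = (N i i - r i : ℕ) := by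
    refine entropy_signal N r (Or.inr ⟨i, Finset.mem_univ i, by omega⟩) fun j _ => ?_
    rcases eq_or_ne j i with rfl | hj
    · omega
    · have := h j hj
      omega
  have hV : entropy (fun U => interference N (tinInput N r U) i) = v i := by
    refine entropy_signal N r (htight.imp_right ?_) fun j hj => h j (Finset.ne_of_mem_erase hj)
    rintro ⟨j, hj, hv⟩
    exact ⟨j, by simpa using hj, hv⟩
  have hXY : entropy (fun U => (tinInput N r U i, output N (tinInput N r U) i)) =
      entropy (fun U => tinInput N r U i) + entropy (fun U => interference N (tinInput N r U) i) := by
    rw [← entropy_pair_of_disjoint {i} (fun U => tinInput N r U i)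
      (fun U => interference N (tinInput N r U) i)
      (fun U V hUV => tinInput_congr N r (hUV i (by simp)))
      fun U V hUV => interference_congr N fun j hj => tinInput_congr N r (hUV j (by simpa using hj))]
    refine entropy_eq_of_determines _ _ fun U V => ?_
    rw [Prod.mk.injEq, Prod.mk.injEq]
    refine and_congr_right fun hX => ?_
    rw [output_eq, output_eq, hX, add_right_inj]
  rw [tinRate, mutualInfo, hXY, hY, hV, Nat.cast_sub (by omega : v i ≤ N i i - r i)]
  ring

end Rate

/-! ### Zero-error codes and the sum-capacity -/

section Achievability

variable {K M : ℕ}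

theorem numMessages_natCast (T d : ℕ) : numMessages T d = 2 ^ (T * d) := by
  rw [numMessages, ← Nat.cast_mul, Real.rpow_natCast]
  exact_mod_cast Nat.ceil_natCast (2 ^ (T * d))

/-- If each transmitter uses only the levels that reach its own receiver above the interference,
then there are no errors. -/
theorem achievable_of_potentials (n : Fin M → Fin K → Fin K → ℕ) (r v : Fin M → Fin K → ℕ)
    (h : ∀ m k i, i ≠ k → n m k i ≤ r m i + v m k) :
    Achievable n fun i => ((∑ m, (n m i i - r m i - v m i) : ℕ) : ℝ) := by
  let d : Fin M → Fin K → ℕ := fun m i => n m i i - r m i - v m i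
  have he : ∀ (T : ℕ) (i : Fin K), Nonempty (Fin (numMessages T ((∑ m, d m i : ℕ) : ℝ)) ≃
      ((Fin T × (Σ m, Fin (d m i))) → ZMod 2)) := fun T i => by
    refine ⟨(Fintype.equivFinOfCardEq ?_).symm⟩
    rw [numMessages_natCast, Fintype.card_fun, ZMod.card, Fintype.card_prod, Fintype.card_sigma]
    simp only [Fintype.card_fin]
  let e : ∀ (T : ℕ) (i : Fin K), Fin (numMessages T ((∑ m, d m i : ℕ) : ℝ)) ≃
      ((Fin T × (Σ m, Fin (d m i))) → ZMod 2) := fun T i => (he T i).some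
  -- Uncoded transmission: the message is written on the bits from `r m i` to `r m i + d m i - 1`
  -- and read off the corresponding received levels. As the rates are integers, the number of
  -- messages is exactly a power of two.
  refine ⟨fun i => Nat.cast_nonneg _, fun T =>
    { enc := fun i w t m b => if hb : r m i ≤ b ∧ b - r m i < d m i
        then e T i w (t, ⟨m, ⟨b - r m i, hb.2⟩⟩) else 0
      dec := fun k y => (e T k).symm fun p =>
        y p.1 p.2.1 (n p.2.1 k k - 1 - (r p.2.1 k + p.2.2)) }, fun k => ?_⟩
  refine (tendsto_congr fun T => ?_).2 tendsto_const_nhds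
  rw [Code.errorProb, div_eq_zero_iff]
  left
  rw [Nat.cast_eq_zero, Nat.card_eq_zero]
  left
  rw [isEmpty_subtype]
  intro w
  rw [not_not, Equiv.symm_apply_eq]
  ext ⟨t, m, b, hb⟩
  have hb' : b < n m k k - r m k - v m k := hb
  simp only [Code.received]
  rw [output_eq, Pi.add_apply, interference_apply]
  -- The level read is at least `v m k`; an interfering bit arriving there would have index below `r
  -- m i`, where nothing is sent.
  refine (add_eq_left.2 (Finset.sum_eq_zero fun i hi => ?_)).trans ?_
  · have := h m k i (Finset.ne_of_mem_erase hi)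
    rw [shift_apply]
    split_ifs
    · omega
    · rfl
    · rfl
  · rw [shift_apply, if_pos (by omega), dif_pos ⟨by omega, by
      change _ < n m k k - r m k - v m k
      omega⟩]
    refine congrArg _ (Prod.ext rfl (Sigma.ext rfl (heq_of_eq (Fin.ext ?_))))
    change n m k k - 1 - (n m k k - 1 - (r m k + b)) - r m k = b
    omega

end Achievability

theorem separateTINAchievesSumCapacity (K M : ℕ) (n : Fin M → Fin K → Fin K → ℕ)
    (P : Fin M → Equiv.Perm (Fin K)) (hopt : ∀ m, OptimalPartition (n m) (P m))
    (hinv : ∀ m, InvertibleUnder (n m) (P m)) (hTIN : ∀ m, TINOptimal (n m)) :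
    SeparateTINAchievesSumCapacity n := by
  choose r v huv htight using fun m => (hopt m).exists_potentials
  have hle : ∀ m i, r m i + v m i ≤ n m i i := fun m => (hTIN m).potential_add_le (htight m)
  have hrates : separateTINRates n r = fun i => ((∑ m, (n m i i - r m i - v m i) : ℕ) : ℝ) := by
    ext i
    rw [separateTINRates, Nat.cast_sum]
    refine Finset.sum_congr rfl fun m _ => ?_
    refine tinRate_eq (n m) (r m) (fun j hj => huv m i j hj) (hle m i) ?_
    -- The edge of the partition entering `i` attains the interference level `v m i`; in a trivial
    -- cycle that level is zero.
    obtain ⟨j, rfl⟩ := (P m).surjective i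
    have h := htight m j
    rcases eq_or_ne (P m j) j with hj | hj
    · rw [edgeWeight, if_pos hj] at h
      exact Or.inl (by omega)
    · rw [edgeWeight_of_ne hj] at h
      exact Or.inr ⟨j, hj.symm, by omega⟩
  have hmem : separateTINRates n r ∈ capacityRegion n := by
    rw [hrates]
    exact subset_closure (achievable_of_potentials n r v huv)
  have hsum : ∑ i, separateTINRates n r i = ∑ m, (cyclicPartitionBound (n m) (P m) : ℝ) := by
    simp only [hrates, Nat.cast_sum]
    rw [Finset.sum_comm]
    exact Finset.sum_congr rfl fun m _ => sum_sub_potentials (hle m) (htight m)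
  refine ⟨r, hmem, ⟨_, hmem, rfl⟩, ?_⟩
  rintro _ ⟨R, hR, rfl⟩
  rw [hsum]
  exact sum_le_of_mem_capacityRegion hTIN P hinv hR

end ADT

theorem theorem7 (K M : ℕ) (n : Fin M → Fin K → Fin K → ℕ) :
    (∀ (m : Fin M) (P : Equiv.Perm (Fin K)),
      (ADT.levelGraph (n m) P).IsAcyclic → ADT.InvertibleUnder (n m) P) ∧
    (∀ m : Fin M,
      (∃ P : Equiv.Perm (Fin K), ADT.OptimalPartition (n m) P ∧ (ADT.levelGraph (n m) P).IsAcyclic) →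
        ADT.Invertible (n m)) ∧
    ((∀ m : Fin M, ∃ P : Equiv.Perm (Fin K),
        ADT.OptimalPartition (n m) P ∧ (ADT.levelGraph (n m) P).IsAcyclic) →
      (∀ m : Fin M, ADT.TINOptimal (n m)) →
        ADT.SeparateTINAchievesSumCapacity n) := by
  refine ⟨fun m P hG => ADT.invertibleUnder_of_isAcyclic hG, fun m => ?_, fun h hTIN => ?_⟩
  · rintro ⟨P, hP, hG⟩
    exact ⟨P, hP, ADT.invertibleUnder_of_isAcyclic hG⟩
  · choose P hP hG using h
    exact ADT.separateTINAchievesSumCapacity K M n P hP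
      (fun m => ADT.invertibleUnder_of_isAcyclic (hG m)) hTIN
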